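/- Let $F_n$ be the free group of rank $n$ on a fixed free basis $X=\{x_1,\dots,x_n\}$. An automorphism $\alpha$ of $F_n$ is called palindromic if each $\alpha(x_i)$ can be written as a palindrome on $X$, that is, as a word in the letters $X^{\pm1}$ that equals its reverse; these automorphisms form a subgroup $\Pi A_n$ of $\mathrm{Aut}(F_n)$. For $i\neq j$ let $P_{ij}$ be the elementary palindromic automorphism that sends $x_i$ to $x_jx_ix_j$ and fixes $x_l$ for all $l\neq i$. For $1\le j\le n$ let the inversion $\iota_j$ send $x_j$ to $x_j^{-1}$ and fix $x_l$ for all $l\ne j$. Let $\Omega^{\pm1}(X)$ be the subgroup of $\mathrm{Aut}(F_n)$ generated by the inversions and the permutations of $X$. **Proposition.** Fix $0\le k\le n$, and let $\Pi A_n(k)$ be the subgroup of $\Pi A_n$ consisting of the palindromic automorphisms that fix each of $x_1,\dots,x_k$ (so $\Pi A_n(0)=\Pi A_n$). Then $$\left[\Omega^{\pm1}(X)\cap \Pi A_n(k)\right]\ \cup\ \{P_{ij} \mid 1\le i,j\le n,\ i\neq j,\ i>k\}$$ is a finite generating set for $\Pi A_n(k)$. -/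

import Mathlib

namespace PalAut

/-- The free group `F_n` on the basis `X = {x_1, …, x_n}`.  The basis element `x_{i+1}` is
`FreeGroup.of i`, for `i : Fin n` (indices start at zero). -/
abbrev F (n : ℕ) : Type := FreeGroup (Fin n)

/-- `g` can be written as a palindrome on `X`: it is represented by some word in the letters
`X^{±1}` (a letter is a pair `(i, b)`, with `b = true` for `x_i` and `b = false` for `x_i⁻¹`)
that is equal to its reverse. -/
def IsPalindrome {n : ℕ} (g : F n) : Prop :=
  ∃ w : List (Fin n × Bool), w.reverse = w ∧ FreeGroup.mk w = g

/-- The automorphism is palindromic: it sends each element of `X` to a palindrome. -/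
def IsPalindromic {n : ℕ} (α : MulAut (F n)) : Prop :=
  ∀ i : Fin n, IsPalindrome (α (FreeGroup.of i))

/-- The endomorphism of `F_n` inverting each element of `X`; only used to check that the
palindromic automorphisms form a subgroup. -/
def invAll (n : ℕ) : F n →* F n := FreeGroup.lift fun i => (FreeGroup.of i)⁻¹

theorem invAll_mk {n : ℕ} (w : List (Fin n × Bool)) :
    invAll n (FreeGroup.mk w) = FreeGroup.mk (w.map fun p => (p.1, !p.2)) := by
  induction w with
  | nil => exact map_one (invAll n)
  | cons p w ih =>
    have h1 : FreeGroup.mk (p :: w) = FreeGroup.mk [p] * FreeGroup.mk w := by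
      rw [FreeGroup.mul_mk]; rfl
    have h2 : invAll n (FreeGroup.mk [p]) = FreeGroup.mk [(p.1, !p.2)] := by
      rcases p with ⟨i, b⟩
      cases b <;> simp [invAll, FreeGroup.of, FreeGroup.inv_mk, FreeGroup.invRev]
    rw [h1, map_mul, ih, h2, FreeGroup.mul_mk]
    rfl

theorem isPalindrome_iff {n : ℕ} (g : F n) : IsPalindrome g ↔ invAll n g = g⁻¹ := by
  constructor
  · rintro ⟨w, hw, rfl⟩
    rw [invAll_mk, FreeGroup.inv_mk, FreeGroup.invRev, ← List.map_reverse, hw]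
  · intro h
    refine ⟨g.toWord, ?_, FreeGroup.mk_toWord⟩
    set w := g.toWord with hw
    have hred : FreeGroup.IsReduced w := FreeGroup.isReduced_toWord
    have hg : FreeGroup.mk w = g := FreeGroup.mk_toWord
    have hflip : FreeGroup.IsReduced (w.map fun p => (p.1, !p.2)) := by
      unfold FreeGroup.IsReduced at hred ⊢
      rw [List.isChain_map]
      exact hred.imp fun a b hab heq => by simpa using hab heq
    have h1 : (w.map fun p => (p.1, !p.2)) = FreeGroup.invRev w := by
      have h2 : (invAll n g).toWord = (g⁻¹).toWord := by rw [h]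
      rw [← hg, invAll_mk, FreeGroup.toWord_mk, hflip.reduce_eq, hg,
        FreeGroup.toWord_inv] at h2
      exact h2
    rw [FreeGroup.invRev, ← List.map_reverse] at h1
    have hinj : Function.Injective (fun p : Fin n × Bool => (p.1, !p.2)) := by
      rintro ⟨a, b⟩ ⟨c, d⟩ hab
      simpa using hab
    exact (List.map_injective_iff.mpr hinj h1).symm

theorem isPalindromic_iff {n : ℕ} (α : MulAut (F n)) :
    IsPalindromic α ↔ ∀ g, invAll n (α g) = α (invAll n g) := by
  constructor
  · intro h
    have : (invAll n).comp α.toMonoidHom = α.toMonoidHom.comp (invAll n) := by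
      ext i
      have := (isPalindrome_iff _).1 (h i)
      simpa [invAll] using this
    exact fun g => DFunLike.congr_fun this g
  · intro h i
    rw [isPalindrome_iff, h]
    simp [invAll]

/-- The palindromic automorphism group `ΠA_n` of `F_n`. -/
def palAut (n : ℕ) : Subgroup (MulAut (F n)) where
  carrier := {α | IsPalindromic α}
  one_mem' := fun i => ⟨[(i, true)], rfl, rfl⟩
  mul_mem' := by
    intro α β hα hβ
    rw [Set.mem_ofPred_eq, isPalindromic_iff] at *
    intro g
    rw [MulAut.mul_apply, MulAut.mul_apply, hα, hβ]
  inv_mem' := by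
    intro α hα
    rw [Set.mem_ofPred_eq, isPalindromic_iff] at *
    intro g
    apply α.injective
    rw [← hα, MulAut.apply_inv_self, MulAut.apply_inv_self]

/-- The subgroup `ΠA_n(k)` of the palindromic automorphisms that fix `x_1, …, x_k`. -/
def palAutFix (n k : ℕ) : Subgroup (MulAut (F n)) where
  carrier := {α | α ∈ palAut n ∧ ∀ i : Fin n, i.val < k → α (FreeGroup.of i) = FreeGroup.of i}
  one_mem' := ⟨one_mem _, fun _ _ => rfl⟩
  mul_mem' := by
    rintro α β ⟨hα, hα'⟩ ⟨hβ, hβ'⟩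
    exact ⟨mul_mem hα hβ, fun i hi => by rw [MulAut.mul_apply, hβ' i hi, hα' i hi]⟩
  inv_mem' := by
    rintro α ⟨hα, hα'⟩
    exact ⟨inv_mem hα, fun i hi => α.injective (by rw [MulAut.apply_inv_self, hα' i hi])⟩

/-- The automorphism of `F_n` that permutes `X` by `σ`. -/
def perm {n : ℕ} (σ : Equiv.Perm (Fin n)) : MulAut (F n) := FreeGroup.freeGroupCongr σ

/-- The endomorphism of `F_n` sending `x_i` to `g` and fixing the other elements of `X`. -/
def replace {n : ℕ} (i : Fin n) (g : F n) : F n →* F n :=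
  FreeGroup.lift (Function.update FreeGroup.of i g)

theorem replace_self {n : ℕ} (i : Fin n) (g : F n) : replace i g (FreeGroup.of i) = g := by
  simp [replace]

theorem replace_of_ne {n : ℕ} {i l : Fin n} (h : l ≠ i) (g : F n) :
    replace i g (FreeGroup.of l) = FreeGroup.of l := by
  simp [replace, h]

/-- The inversion `ι_j`: it sends `x_j` to `x_j⁻¹` and fixes the other elements of `X`. -/
def inversion {n : ℕ} (j : Fin n) : MulAut (F n) :=
  MonoidHom.toMulEquiv (replace j (FreeGroup.of j)⁻¹) (replace j (FreeGroup.of j)⁻¹)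
    (by
      ext l
      by_cases h : l = j
      · subst h; simp [replace_self]
      · simp [replace_of_ne h])
    (by
      ext l
      by_cases h : l = j
      · subst h; simp [replace_self]
      · simp [replace_of_ne h])

/-- The elementary palindromic automorphism `P_ij` (`i ≠ j`): it sends `x_i` to `x_j x_i x_j`
and fixes the other elements of `X`. -/
def elementary {n : ℕ} (i j : Fin n) (hij : i ≠ j) : MulAut (F n) :=
  MonoidHom.toMulEquiv
    (replace i (FreeGroup.of j * FreeGroup.of i * FreeGroup.of j))
    (replace i ((FreeGroup.of j)⁻¹ * FreeGroup.of i * (FreeGroup.of j)⁻¹))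
    (by
      ext l
      by_cases h : l = i
      · subst h; simp [replace_self, replace_of_ne hij.symm, mul_assoc]
      · simp [replace_of_ne h])
    (by
      ext l
      by_cases h : l = i
      · subst h; simp [replace_self, replace_of_ne hij.symm, mul_assoc]
      · simp [replace_of_ne h])

/-- The group `Ω^{±1}(X)` generated by the inversions and the permutations of `X`. -/
def signedPerms (n : ℕ) : Subgroup (MulAut (F n)) :=
  Subgroup.closure (Set.range (inversion (n := n)) ∪ Set.range (perm (n := n)))

/-- The set `[Ω^{±1}(X) ∩ ΠA_n(k)] ∪ {P_ij | i > k}`; since `Fin n` starts at zero, the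
condition `i > k` on the index of `x_i` reads `k ≤ i.val`. -/
def generators (n k : ℕ) : Set (MulAut (F n)) :=
  ((signedPerms n : Set (MulAut (F n))) ∩ (palAutFix n k : Set (MulAut (F n)))) ∪
    {P | ∃ (i j : Fin n) (hij : i ≠ j), k ≤ i.val ∧ P = elementary i j hij}

end PalAut

namespace PalAut

variable {n : ℕ}

/-! This is Nielsen reduction for palindromes. A palindromic `α` sends each letter to an odd reduced
palindrome, determined by its half: the left part together with the middle letter. If the half for
one letter is a prefix of the half for a letter of another index, composing `α` with some
`P_ij^{±1}` shortens one image and keeps the others. If there is no such prefix, cancellation never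
reaches a middle letter (`exists_junction`), so `α` does not shorten reduced words
(`exists_reduced_image`). Applied to `α⁻¹(x_l)`, this makes `α⁻¹` permute the letters, so `α` is a
signed permutation. Induction on the total length of the images concludes. A fixed `x_i` has length
1 and cannot be shortened, so the `P_ij` used automatically satisfy `i > k`. -/

/-! ### Palindromes as reduced words -/

/-- The letter `x_i^{∓1}` inverse to the letter `x_i^{±1}`. -/
def flip (a : Fin n × Bool) : Fin n × Bool := (a.1, !a.2)

@[simp] theorem flip_flip (a : Fin n × Bool) : flip (flip a) = a := by simp [flip]

theorem mk_flip (a : Fin n × Bool) : (FreeGroup.mk [flip a] : F n) = (FreeGroup.mk [a])⁻¹ := by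
  simp [flip, FreeGroup.inv_mk, FreeGroup.invRev]

theorem invRev_eq_reverse_map_flip (w : List (Fin n × Bool)) :
    FreeGroup.invRev w = (w.map flip).reverse := rfl

theorem mk_singleton_injective {a b : Fin n × Bool}
    (h : (FreeGroup.mk [a] : F n) = FreeGroup.mk [b]) : a = b := by
  have := FreeGroup.reduce.sound h
  simpa using this

/-- Inverting every letter keeps a word reduced, so `invAll n g = g⁻¹` is an equality of reduced
words. -/
theorem IsPalindrome.reverse_toWord {g : F n} (hg : IsPalindrome g) :
    g.toWord.reverse = g.toWord := by
  have h := (isPalindrome_iff g).1 hg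
  have hflip : FreeGroup.IsReduced (g.toWord.map flip) := by
    have hred : FreeGroup.IsReduced g.toWord := FreeGroup.isReduced_toWord
    unfold FreeGroup.IsReduced at hred ⊢
    rw [List.isChain_map]
    exact hred.imp fun a b hab heq => by simpa [flip] using hab heq
  have h1 : invAll n g = FreeGroup.mk (g.toWord.map flip) := by
    conv_lhs => rw [← FreeGroup.mk_toWord (x := g)]
    exact invAll_mk _
  have h2 : g.toWord.map flip = (g.toWord.reverse).map flip := by
    rw [← hflip.reduce_eq, ← FreeGroup.toWord_mk, ← h1, h, FreeGroup.toWord_inv,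
      invRev_eq_reverse_map_flip, List.map_reverse]
  exact (List.map_injective_iff.mpr (Function.LeftInverse.injective flip_flip) h2).symm

theorem exists_eq_of_palindrome {β : Type*} {l : List β} (h : l.Palindrome) :
    (∃ u, l = u ++ u.reverse) ∨ ∃ u c, l = u ++ c :: u.reverse := by
  induction h with
  | nil => exact Or.inl ⟨[], rfl⟩
  | singleton x => exact Or.inr ⟨[], x, rfl⟩
  | cons_concat x _ ih =>
    rcases ih with ⟨u, rfl⟩ | ⟨u, c, rfl⟩
    · exact Or.inl ⟨x :: u, by simp⟩
    · exact Or.inr ⟨x :: u, c, by simp⟩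

theorem map_mk_reverse {A : Type*} [CommGroup A] (ψ : F n →* A) (u : List (Fin n × Bool)) :
    ψ (FreeGroup.mk u.reverse) = ψ (FreeGroup.mk u) := by
  induction u with
  | nil => rfl
  | cons a u ih =>
    have h : FreeGroup.mk (a :: u) = FreeGroup.mk [a] * FreeGroup.mk u := by
      rw [FreeGroup.mul_mk]; rfl
    rw [List.reverse_cons, ← FreeGroup.mul_mk, map_mul, ih, h, map_mul, mul_comm]

/-- The image of a basis element under a palindromic automorphism has odd length. -/
theorem IsPalindromic.exists_toWord_eq {α : MulAut (F n)} (hα : IsPalindromic α) (i : Fin n) :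
    ∃ u c, (α (FreeGroup.of i)).toWord = u ++ c :: u.reverse := by
  refine (exists_eq_of_palindrome (.of_reverse_eq (hα i).reverse_toWord)).resolve_left ?_
  rintro ⟨u, hu⟩
  -- `ψ` is exponent parity after `α⁻¹`: it is odd on `α(x_i)` but even on any `u ++ u.reverse`.
  let φ : F n →* Multiplicative (ZMod 2) := FreeGroup.lift fun _ => Multiplicative.ofAdd 1
  let ψ : F n →* Multiplicative (ZMod 2) := φ.comp (α⁻¹ : MulAut (F n)).toMonoidHom
  have h1 : ψ (α (FreeGroup.of i)) = Multiplicative.ofAdd 1 := by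
    change φ (α⁻¹ (α (FreeGroup.of i))) = _
    rw [MulAut.inv_apply_self]
    simp [φ]
  rw [← FreeGroup.mk_toWord (x := α (FreeGroup.of i)), hu, ← FreeGroup.mul_mk, map_mul,
    map_mk_reverse] at h1
  generalize ψ (FreeGroup.mk u) = z at h1
  revert z
  decide

theorem exists_prefix_split {β : Type*} : ∀ {X Y : List β}, ¬ X <+: Y → ¬ Y <+: X →
    ∃ p c d X' Y', X = p ++ c :: X' ∧ Y = p ++ d :: Y' ∧ c ≠ d
  | [], _, h, _ => absurd List.nil_prefix h
  | _ :: _, [], _, h => absurd List.nil_prefix h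
  | x :: X, y :: Y, h, h' => by
    by_cases hxy : x = y
    · subst hxy
      obtain ⟨p, c, d, X', Y', rfl, rfl, hcd⟩ := exists_prefix_split
        (fun hp => h ((List.prefix_cons_inj x).2 hp))
        (fun hp => h' ((List.prefix_cons_inj x).2 hp))
      exact ⟨x :: p, c, d, X', Y', rfl, rfl, hcd⟩
    · exact ⟨[], x, y, X, Y, rfl, rfl, hxy⟩

/-! ### Nielsen-reduced palindromic systems -/

/-- A palindromic system: odd reduced palindromes `L a ++ m a :: (L a).reverse` assigned to the
letters, compatibly with inversion, such that no half of one extends a half of another. -/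
structure IsNielsenReduced (L : Fin n × Bool → List (Fin n × Bool))
    (m : Fin n × Bool → Fin n × Bool) : Prop where
  left_flip : ∀ a, L (flip a) = (L a).map flip
  mid_flip : ∀ a, m (flip a) = flip (m a)
  isReduced : ∀ a, FreeGroup.IsReduced (L a ++ m a :: (L a).reverse)
  not_prefix : ∀ a b, a.1 ≠ b.1 → ¬ (L a ++ [m a]) <+: (L b ++ [m b])

namespace IsNielsenReduced

variable {L : Fin n × Bool → List (Fin n × Bool)} {m : Fin n × Bool → Fin n × Bool}

theorem isReduced_left (h : IsNielsenReduced L m) (a : Fin n × Bool) :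
    FreeGroup.IsReduced (L a ++ [m a]) :=
  (h.isReduced a).infix ⟨[], (L a).reverse, by simp⟩

theorem isReduced_right (h : IsNielsenReduced L m) (a : Fin n × Bool) :
    FreeGroup.IsReduced (m a :: (L a).reverse) :=
  (h.isReduced a).infix ⟨L a, [], by simp⟩

/-- Cancellation between two consecutive factors leaves both middle letters intact; `z` is what
remains between them. -/
theorem exists_junction (h : IsNielsenReduced L m) {a b : Fin n × Bool}
    (hab : a.1 = b.1 → a.2 = b.2) :
    ∃ z, FreeGroup.IsReduced (m a :: z ++ [m b]) ∧
      (FreeGroup.mk z : F n) = FreeGroup.mk ((L a).reverse ++ L b) := by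
  by_cases hi : a.1 = b.1
  -- For equal letters nothing cancels: the two letters that meet are equal, hence not mutually
  -- inverse.
  · obtain rfl : a = b := Prod.ext hi (hab hi)
    refine ⟨(L a).reverse ++ L a, ?_, rfl⟩
    have h1 := h.isReduced_left a
    have h2 := h.isReduced_right a
    have h3 : m a :: ((L a).reverse ++ L a) ++ [m a] =
        (m a :: (L a).reverse) ++ (L a ++ [m a]) := by simp
    rw [h3]
    refine List.isChain_append.2 ⟨h2, h1, fun x hx y hy hxy => ?_⟩
    have h4 : m a :: (L a).reverse = (L a ++ [m a]).reverse := by simp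
    rw [h4, List.getLast?_reverse] at hx
    rw [Option.mem_unique hx hy]
  -- The inverse of the right half of `a` is the left half of `flip a`. Its common prefix `p` with
  -- the left half of `b` is exactly what cancels, and both halves continue past `p`, with distinct
  -- letters `c` and `d`.
  · have hX : L (flip a) ++ [m (flip a)] = ((m a :: (L a).reverse).map flip).reverse := by
      simp [h.left_flip, h.mid_flip]
    obtain ⟨p, c, d, X', Y', hpc, hpd, hcd⟩ := exists_prefix_split
      (h.not_prefix (flip a) b hi) (h.not_prefix b (flip a) (Ne.symm hi))
    have hR : m a :: (L a).reverse =
        ((X'.map flip).reverse ++ [flip c]) ++ (p.map flip).reverse := by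
      have : (L (flip a) ++ [m (flip a)]).reverse.map flip = m a :: (L a).reverse := by
        rw [hX]; simp [Function.comp_def]
      rw [← this, hpc]; simp
    obtain ⟨s, hs⟩ : ∃ s, (X'.map flip).reverse ++ [flip c] = m a :: s := by
      rcases hu : (X'.map flip).reverse ++ [flip c] with _ | ⟨x, s⟩
      · simp at hu
      · rw [hu] at hR
        simp only [List.cons_append, List.cons.injEq] at hR
        exact ⟨s, by rw [hR.1]⟩
    obtain ⟨t, ht⟩ : ∃ t, d :: Y' = t ++ [m b] := by
      rcases List.eq_nil_or_concat (d :: Y') with hu | ⟨t, y, hu⟩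
      · simp at hu
      · rw [hu, List.concat_eq_append, ← List.append_assoc] at hpd
        have := List.append_inj_right' hpd rfl
        exact ⟨t, by rw [hu, List.concat_eq_append, this]⟩
    have hLa : (L a).reverse = s ++ (p.map flip).reverse := by
      rw [hs] at hR
      simpa using hR
    have hLb : L b = p ++ t := by
      rw [ht, ← List.append_assoc] at hpd
      exact List.append_inj_left' hpd rfl
    refine ⟨s ++ t, ?_, ?_⟩
    · have h3 : m a :: (s ++ t) ++ [m b] = (m a :: s) ++ (t ++ [m b]) := by simp
      rw [h3, ← hs, ← ht]
      refine List.isChain_append.2 ⟨(h.isReduced_right a).infix ?_,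
        (h.isReduced_left b).infix ?_, ?_⟩
      · exact ⟨[], _, hR.symm⟩
      · exact ⟨p, [], by rw [hpd, List.append_nil]⟩
      · intro x hx y hy hxy
        simp only [List.getLast?_append, List.getLast?_singleton, Option.some_or,
          Option.mem_def, Option.some.injEq, List.head?_cons] at hx hy
        subst hx hy
        by_contra hne
        apply hcd
        simp only [flip] at hxy hne
        refine Prod.ext hxy ?_
        simpa using hne
    · rw [hLa, hLb, ← invRev_eq_reverse_map_flip]
      simp only [← FreeGroup.mul_mk, ← FreeGroup.inv_mk]
      group

/-- The middle letters of the factors survive in the image of a reduced word. -/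
theorem exists_reduced_image (h : IsNielsenReduced L m) (φ : F n →* F n)
    (hφ : ∀ a, φ (FreeGroup.mk [a]) = FreeGroup.mk (L a ++ m a :: (L a).reverse)) :
    ∀ (w : List (Fin n × Bool)) (a : Fin n × Bool), FreeGroup.IsReduced (a :: w) →
      ∃ t, w.length ≤ t.length ∧ FreeGroup.IsReduced (L a ++ m a :: t) ∧
        φ (FreeGroup.mk (a :: w)) = FreeGroup.mk (L a ++ m a :: t)
  | [], a, _ => ⟨(L a).reverse, Nat.zero_le _, h.isReduced a, hφ a⟩
  | b :: w, a, hw => by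
    have hw' := List.isChain_cons_cons.1 hw
    obtain ⟨t, hlen, hred, ht⟩ := exists_reduced_image h φ hφ w b hw'.2
    obtain ⟨z, hz, hmk⟩ := h.exists_junction hw'.1
    refine ⟨z ++ m b :: t, ?_, ?_, ?_⟩
    · simp only [List.length_cons, List.length_append]; omega
    · have hbt : FreeGroup.IsReduced (m b :: t) := hred.infix ⟨L b, [], by simp⟩
      -- Reduced words overlapping in one middle letter glue to a reduced word.
      have h1 : FreeGroup.IsReduced (m a :: z ++ [m b] ++ t) :=
        FreeGroup.IsReduced.append_overlap hz hbt (by simp)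
      have h2 : FreeGroup.IsReduced (L a ++ [m a] ++ (z ++ [m b] ++ t)) :=
        FreeGroup.IsReduced.append_overlap (h.isReduced_left a) (by simpa using h1) (by simp)
      simpa using h2
    · have h3 : FreeGroup.mk (a :: b :: w) = FreeGroup.mk [a] * FreeGroup.mk (b :: w) := by
        rw [FreeGroup.mul_mk]; rfl
      have h4 : L a ++ m a :: (z ++ m b :: t) = (L a ++ [m a]) ++ (z ++ m b :: t) := by simp
      have h5 : L a ++ m a :: (L a).reverse = (L a ++ [m a]) ++ (L a).reverse := by simp
      rw [h3, map_mul, hφ, ht, h4, h5]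
      rw [← FreeGroup.mul_mk (L₁ := L a ++ [m a]), ← FreeGroup.mul_mk (L₁ := L a ++ [m a]),
        ← FreeGroup.mul_mk (L₁ := z), hmk]
      simp only [← FreeGroup.mul_mk, mul_assoc]

end IsNielsenReduced

/-! ### Signed permutations -/

/-- An automorphism permuting the letters `X^{±1}` is a signed permutation. -/
theorem mem_signedPerms_of_letters {β : MulAut (F n)}
    (h : ∀ i, ∃ a, β (FreeGroup.of i) = FreeGroup.mk [a]) : β ∈ signedPerms n := by
  -- `s` contains every index whose image may be an inverse letter; composing with an inversion
  -- removes one.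
  suffices H : ∀ (s : Finset (Fin n)) (β : MulAut (F n)),
      (∀ i, ∃ a, β (FreeGroup.of i) = FreeGroup.mk [a]) →
      (∀ i ∉ s, ∃ j, β (FreeGroup.of i) = FreeGroup.of j) → β ∈ signedPerms n from
    H Finset.univ β h fun i hi => absurd (Finset.mem_univ i) hi
  intro s
  induction s using Finset.induction_on with
  | empty =>
    intro β _ hβ
    choose f hf using fun i => hβ i (Finset.notMem_empty i)
    have hinj : Function.Injective f := fun i j hij =>
      FreeGroup.of_injective (β.injective (by rw [hf, hf, hij]))
    have : β = perm (Equiv.ofBijective f (Finite.injective_iff_bijective.1 hinj)) := by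
      apply MulEquiv.toMonoidHom_injective
      ext i
      simp [perm, hf]
    rw [this]
    exact Subgroup.subset_closure (Or.inr ⟨_, rfl⟩)
  | insert i s _ ih =>
    intro β hβ hs
    obtain ⟨⟨j, b⟩, hj⟩ := hβ i
    cases b with
    | true =>
      refine ih β hβ fun l hl => ?_
      by_cases hli : l = i
      · exact ⟨j, hli ▸ hj⟩
      · exact hs l (by simp [hli, hl])
    | false =>
      have hi : (β * inversion i) (FreeGroup.of i) = FreeGroup.of j := by
        have : inversion i (FreeGroup.of i) = (FreeGroup.of i)⁻¹ := replace_self i _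
        rw [MulAut.mul_apply, this, map_inv, hj, FreeGroup.inv_mk]
        rfl
      have hne : ∀ l, l ≠ i → (β * inversion i) (FreeGroup.of l) = β (FreeGroup.of l) := by
        intro l hl
        have : inversion i (FreeGroup.of l) = FreeGroup.of l := replace_of_ne hl _
        rw [MulAut.mul_apply, this]
      have hmem : β * inversion i ∈ signedPerms n := by
        refine ih _ (fun l => ?_) fun l hl => ?_
        · by_cases hli : l = i
          · exact ⟨(j, true), hli ▸ hi⟩
          · rw [hne l hli]; exact hβ l
        · by_cases hli : l = i
          · exact ⟨j, hli ▸ hi⟩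
          · rw [hne l hli]; exact hs l (by simp [hli, hl])
      exact ((signedPerms n).mul_mem_cancel_right
        (Subgroup.subset_closure (Or.inl ⟨i, rfl⟩))).1 hmem

-- Signed permutations preserve the finite set of letters, and an automorphism is determined by its
-- values on the basis.
open scoped Pointwise in
theorem signedPerms_finite : (signedPerms n : Set (MulAut (F n))).Finite := by
  let S : Set (F n) := Set.range fun a : Fin n × Bool => FreeGroup.mk [a]
  have hS : S.Finite := Set.finite_range _
  have hle : signedPerms n ≤ MulAction.stabilizer (MulAut (F n)) S := by
    refine (Subgroup.closure_le _).2 ?_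
    suffices H : ∀ β ∈ Set.range (inversion (n := n)) ∪ Set.range (perm (n := n)),
        ∀ i, β (FreeGroup.of i) ∈ S by
      intro β hβ
      refine (MulAction.mem_stabilizer_set_iff_smul_set_subset hS).2 ?_
      rintro _ ⟨_, ⟨⟨i, b⟩, rfl⟩, rfl⟩
      obtain ⟨a, ha⟩ := H β hβ i
      cases b with
      | true => exact ⟨a, ha⟩
      | false =>
        refine ⟨flip a, ?_⟩
        change FreeGroup.mk [flip a] = β (FreeGroup.mk [flip (i, true)])
        rw [mk_flip, mk_flip, map_inv]
        exact congrArg _ ha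
    rintro _ (⟨j, rfl⟩ | ⟨σ, rfl⟩) i
    · by_cases hij : i = j
      · subst hij
        exact ⟨(i, false), (replace_self i _).symm⟩
      · exact ⟨(i, true), (replace_of_ne hij _).symm⟩
    · exact ⟨(σ i, true), by simp [perm]; rfl⟩
  have hfin : (Set.univ.pi fun _ : Fin n => S).Finite := Set.Finite.pi fun _ => hS
  refine Set.Finite.of_injOn (f := fun β (i : Fin n) => β (FreeGroup.of i)) ?_ ?_ hfin
  · intro β hβ i _
    have h : β • S = S := hle hβ
    rw [← h]
    exact ⟨FreeGroup.of i, ⟨(i, true), rfl⟩, rfl⟩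
  · intro β _ γ _ h
    apply MulEquiv.toMonoidHom_injective
    ext i
    exact congrFun h i

theorem generators_finite (n k : ℕ) : (generators n k).Finite := by
  refine (signedPerms_finite.subset Set.inter_subset_left).union ?_
  refine (Set.finite_range fun p : {p : Fin n × Fin n // p.1 ≠ p.2} =>
    elementary p.1.1 p.1.2 p.2).subset ?_
  rintro _ ⟨i, j, hij, _, rfl⟩
  exact ⟨⟨(i, j), hij⟩, rfl⟩

/-! ### Shortening by elementary palindromic automorphisms -/

theorem elementary_apply_self {i j : Fin n} (hij : i ≠ j) :
    elementary i j hij (FreeGroup.of i) = FreeGroup.of j * FreeGroup.of i * FreeGroup.of j :=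
  replace_self i _

theorem elementary_apply_of_ne {i j l : Fin n} (hij : i ≠ j) (hl : l ≠ i) :
    elementary i j hij (FreeGroup.of l) = FreeGroup.of l :=
  replace_of_ne hl _

theorem elementary_inv_apply_self {i j : Fin n} (hij : i ≠ j) :
    (elementary i j hij)⁻¹ (FreeGroup.of i) =
      (FreeGroup.of j)⁻¹ * FreeGroup.of i * (FreeGroup.of j)⁻¹ :=
  replace_self i _

theorem elementary_mem_palAutFix {k : ℕ} {i j : Fin n} (hij : i ≠ j) (hi : k ≤ i.val) :
    elementary i j hij ∈ palAutFix n k := by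
  refine ⟨fun l => ?_, fun l hl => elementary_apply_of_ne hij fun h => ?_⟩
  · by_cases hl : l = i
    · subst hl
      exact ⟨[(j, true), (l, true), (j, true)], rfl, (elementary_apply_self hij).symm⟩
    · exact ⟨[(l, true)], rfl, (elementary_apply_of_ne hij hl).symm⟩
  · subst h; omega

/-- A palindromic automorphism that is not a signed permutation can be shortened by an elementary
palindromic automorphism or its inverse. -/
theorem IsPalindromic.exists_shortening {α : MulAut (F n)} (hα : IsPalindromic α)
    (hns : α ∉ signedPerms n) :
    ∃ (i j : Fin n) (hij : i ≠ j),
      (α (elementary i j hij (FreeGroup.of i))).norm < (α (FreeGroup.of i)).norm ∨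
      (α ((elementary i j hij)⁻¹ (FreeGroup.of i))).norm < (α (FreeGroup.of i)).norm := by
  choose u c huc using hα.exists_toWord_eq
  let L : Fin n × Bool → List (Fin n × Bool) := fun a => if a.2 then u a.1 else (u a.1).map flip
  let m : Fin n × Bool → Fin n × Bool := fun a => if a.2 then c a.1 else flip (c a.1)
  have hword : ∀ a, (α (FreeGroup.mk [a])).toWord = L a ++ m a :: (L a).reverse := by
    rintro ⟨i, _ | _⟩
    · have h1 : (FreeGroup.mk [(i, false)] : F n) = (FreeGroup.of i)⁻¹ := mk_flip (i, true)
      rw [h1, map_inv, FreeGroup.toWord_inv, huc, invRev_eq_reverse_map_flip]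
      simp [L, m]
    · exact huc i
  have hmk : ∀ a, α (FreeGroup.mk [a]) = FreeGroup.mk (L a ++ m a :: (L a).reverse) := fun a => by
    rw [← hword, FreeGroup.mk_toWord]
  by_contra hno
  push Not at hno
  apply hns
  have hN : IsNielsenReduced L m := by
    refine ⟨?_, ?_, fun a => ?_, ?_⟩
    · rintro ⟨i, _ | _⟩ <;> simp [L, flip, Function.comp_def]
    · rintro ⟨i, _ | _⟩ <;> simp [m, flip]
    · rw [← hword]; exact FreeGroup.isReduced_toWord
    · intro a b hab hpre
      rcases List.prefix_concat_iff.1 hpre with heq | ⟨v, hv⟩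
      · obtain ⟨hL, hm⟩ := List.append_inj' heq rfl
        have := α.injective ((hmk a).trans ((by rw [hL, List.singleton_inj.1 hm] : _ = _).trans
          (hmk b).symm))
        exact hab (congrArg Prod.fst (mk_singleton_injective this))
      -- With `L b = L a ++ [m a] ++ v`, multiplying by the inverse image of `a` on both sides
      -- replaces `L a ++ [m a]` by a word of length `|L a|` at each end, saving two letters.
      · have hlt : (α ((FreeGroup.mk [a])⁻¹ * FreeGroup.mk [b] * (FreeGroup.mk [a])⁻¹)).norm <
            (α (FreeGroup.mk [b])).norm := by
          have hb : (α (FreeGroup.mk [b])).norm = 2 * (L b).length + 1 := by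
            rw [FreeGroup.norm, hword]; simp; omega
          have hvlen : (L b).length = (L a).length + 1 + v.length := by rw [← hv]; simp; omega
          have hz : α ((FreeGroup.mk [a])⁻¹ * FreeGroup.mk [b] * (FreeGroup.mk [a])⁻¹) =
              FreeGroup.mk (FreeGroup.invRev (L a).reverse ++ (v ++ [m b] ++ v.reverse) ++
                FreeGroup.invRev (L a)) := by
            have e1 : L b ++ m b :: (L b).reverse = L a ++ [m a] ++ (v ++ [m b] ++ v.reverse) ++
                ([m a] ++ (L a).reverse) := by rw [← hv]; simp
            have e2 : L a ++ m a :: (L a).reverse = L a ++ [m a] ++ (L a).reverse := by simp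
            rw [map_mul, map_mul, map_inv, hmk, hmk, e1, e2]
            simp only [← FreeGroup.mul_mk, ← FreeGroup.inv_mk]
            group
          rw [hz, hb]
          refine FreeGroup.norm_mk_le.trans_lt ?_
          simp
          omega
        obtain ⟨j, e⟩ := a
        obtain ⟨i, b⟩ := b
        have hij : i ≠ j := Ne.symm hab
        obtain ⟨h1, h2⟩ := hno i j hij
        rw [elementary_apply_self] at h1
        rw [elementary_inv_apply_self] at h2
        have ht : ∀ l : Fin n, (FreeGroup.mk [(l, true)] : F n) = FreeGroup.of l := fun _ => rfl
        have hf : ∀ l : Fin n, (FreeGroup.mk [(l, false)] : F n) = (FreeGroup.of l)⁻¹ :=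
          fun l => mk_flip (l, true)
        refine absurd hlt (not_lt.2 ?_)
        -- For each choice of signs, `a⁻¹ b a⁻¹` is `P_ij^{±1}(x_i)` or its inverse, and inversion
        -- preserves length.
        cases e <;> cases b <;> simp only [ht, hf, inv_inv]
        · rw [map_inv, FreeGroup.norm_inv_eq]
          refine h2.trans_eq ?_
          rw [← FreeGroup.norm_inv_eq, ← map_inv]
          simp only [mul_inv_rev, inv_inv, mul_assoc]
        · exact h1
        · rw [map_inv, FreeGroup.norm_inv_eq]
          refine h1.trans_eq ?_
          rw [← FreeGroup.norm_inv_eq, ← map_inv]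
          simp only [mul_inv_rev, mul_assoc]
        · exact h2
  rw [← inv_mem_iff]
  refine mem_signedPerms_of_letters fun l => ?_
  have hrec : FreeGroup.mk (α⁻¹ (FreeGroup.of l)).toWord = α⁻¹ (FreeGroup.of l) :=
    FreeGroup.mk_toWord
  have hred : FreeGroup.IsReduced (α⁻¹ (FreeGroup.of l)).toWord := FreeGroup.isReduced_toWord
  rcases hw : (α⁻¹ (FreeGroup.of l)).toWord with _ | ⟨a, w⟩
  · rw [FreeGroup.toWord_eq_nil_iff, EmbeddingLike.map_eq_one_iff] at hw
    exact absurd hw (FreeGroup.of_ne_one l)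
  · rw [hw] at hrec hred
    -- The image of `a :: w` has length at least `|w| + 1`, but it is the single letter `x_l`; hence
    -- `w` is empty.
    obtain ⟨t, hlen, htred, ht⟩ := hN.exists_reduced_image α.toMonoidHom hmk w a hred
    have h1 : α (FreeGroup.mk (a :: w)) = FreeGroup.of l := by
      rw [hrec, MulAut.apply_inv_self]
    have h2 : L a ++ m a :: t = [(l, true)] := by
      rw [← htred.reduce_eq, ← FreeGroup.toWord_mk, ← ht, ← FreeGroup.toWord_of]
      exact congrArg _ h1
    have h3 := congrArg List.length h2
    simp only [List.length_append, List.length_cons, List.length_nil] at h3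
    obtain rfl : w = [] := List.length_eq_zero_iff.1 (by omega)
    exact ⟨a, hrec.symm⟩

/-! ### Generation by descent on total length -/

theorem closure_generators_le (n k : ℕ) :
    Subgroup.closure (generators n k) ≤ palAutFix n k := by
  refine (Subgroup.closure_le _).2 ?_
  rintro _ (h | ⟨i, j, hij, hi, rfl⟩)
  · exact h.2
  · exact elementary_mem_palAutFix hij hi

theorem palAutFix_le_closure_generators (n k : ℕ) :
    palAutFix n k ≤ Subgroup.closure (generators n k) := by
  intro α hα
  induction hN : ∑ l, (α (FreeGroup.of l)).norm using Nat.strong_induction_on generalizing α with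
  | _ N ih =>
    subst hN
    by_cases hs : α ∈ signedPerms n
    · exact Subgroup.subset_closure (Or.inl ⟨hs, hα⟩)
    obtain ⟨i, j, hij, hshort⟩ := IsPalindromic.exists_shortening hα.1 hs
    have hi : k ≤ i.val := by
      by_contra hlt
      -- If `α` fixes `x_i`, a shorter image has length 0, which is impossible for the image of a
      -- basis element.
      have hpos : ∀ g : F n, (α g).norm < (α (FreeGroup.of i)).norm → g = 1 := fun g hg => by
        rw [hα.2 i (not_le.1 hlt), FreeGroup.norm_of, Nat.lt_one_iff, FreeGroup.norm_eq_zero,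
          EmbeddingLike.map_eq_one_iff] at hg
        exact hg
      rcases hshort with h | h <;>
        exact FreeGroup.of_ne_one i ((EmbeddingLike.map_eq_one_iff).1 (hpos _ h))
    have hmemP : elementary i j hij ∈ Subgroup.closure (generators n k) :=
      Subgroup.subset_closure (Or.inr ⟨i, j, hij, hi, rfl⟩)
    have hstep : ∀ P : MulAut (F n), P ∈ Subgroup.closure (generators n k) →
        (∀ l, l ≠ i → P (FreeGroup.of l) = FreeGroup.of l) →
        (α (P (FreeGroup.of i))).norm < (α (FreeGroup.of i)).norm →
        α ∈ Subgroup.closure (generators n k) := by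
      intro P hP hfix hlt
      refine (Subgroup.mul_mem_cancel_right _ hP).1 (ih _ ?_
        (mul_mem hα (closure_generators_le n k hP)) rfl)
      refine Finset.sum_lt_sum (fun l _ => ?_) ⟨i, Finset.mem_univ i, hlt⟩
      by_cases hl : l = i
      · exact hl ▸ hlt.le
      · rw [MulAut.mul_apply, hfix l hl]
    rcases hshort with h | h
    · exact hstep _ hmemP (fun l hl => elementary_apply_of_ne hij hl) h
    · exact hstep _ (inv_mem hmemP) (fun l hl => replace_of_ne hl _) h

end PalAut

theorem mainTheorem4 (n k : ℕ) (hk : k ≤ n) :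
    (PalAut.generators n k).Finite ∧
      Subgroup.closure (PalAut.generators n k) = PalAut.palAutFix n k :=
  ⟨PalAut.generators_finite n k,
    le_antisymm (PalAut.closure_generators_le n k) (PalAut.palAutFix_le_closure_generators n k)⟩
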